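/- Let $\pi:\mathbb{CP}^3\to\mathbb{HP}^1\cong\mathbb S^4$, $\pi[X_0,X_1,X_2,X_3]=[X_0+X_1j,\,X_2+X_3j]$, be the twistor fibration, where $\mathbb{HP}^1$ is the left quaternionic projective line ($[q_1,q_2]=[pq_1,pq_2]$ for $p\in\mathbb H\setminus\{0\}$), and embed $\mathbb H\subset\mathbb{HP}^1$ by $q\mapsto[1,q]$, with $\infty=[0,1]$. Let $\hat{\mathbb C}_i=\mathbb C_i\cup\{\infty\}\subset\mathbb{HP}^1$, where $\mathbb C_i=\mathbb R+\mathbb Ri\subset\mathbb H$; it is a $2$-sphere. For a surface $\mathcal K\subset\mathbb{CP}^3$ of degree $d$ put $Disc(\mathcal K)=\{q\in\mathbb{HP}^1:\#(\pi^{-1}(q)\cap\mathcal K)\ne d\}$, $G_0=\{q\in Disc(\mathcal K):\pi^{-1}(q)\subset\mathcal K\}$, and $G_n=\{q\in\mathbb{HP}^1:\#(\pi^{-1}(q)\cap\mathcal K)=n\}$ for $1\le n<d$. Let $\mathcal C\subset\mathbb{CP}^3$ be the cubic scroll $X_0X_3^2+X_1^2X_2=0$. Then its discriminant locus is the singular surface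 $$Disc(\mathcal C)=\Sigma=\hat{\mathbb C}_i\ \cup\bigcup_{\substack{P\in\{0,\infty\}\\ z\in\mathbb C_i,\ z^3=-1}}\Sigma_{P,z},$$ where $\Sigma_{P,z}$ is a handle pinched to $\hat{\mathbb C}_i$ at $P$ and $z$. That is, let $M$ be the quotient space obtained from the disjoint union of $\hat{\mathbb C}_i$ and six cylinders $\mathbb S^1\times[0,1]$, one for each pair $(P,z)$, by collapsing, for each $(P,z)$, the boundary circle $\mathbb S^1\times\{0\}$ of its cylinder to the point $P\in\hat{\mathbb C}_i$ and $\mathbb S^1\times\{1\}$ to the point $z\in\hat{\mathbb C}_i$; then there is a topological embedding $F:M\to\mathbb{HP}^1$ that restricts to the inclusion on $\hat{\mathbb C}_i$ and has image $Disc(\mathcal C)$, and $\Sigma_{P,z}$ is the image under $F$ of the cylinder with index $(P,z)$. Moreover $$G_0=\left\{0,\,-1,\,\tfrac12+\tfrac{\sqrt3}{2}i,\,\tfrac12-\tfrac{\sqrt3}{2}i,\,\infty\right\},\qquad G_1=\emptyset,\qquad G_2=\Sigma\setminus G_0 .$$ -/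

import Mathlib

open scoped LinearAlgebra.Projectivization Quaternion Topology

noncomputable section

/-- The complex projective space `ℂℙ³`, with homogeneous coordinates `[X₀, X₁, X₂, X₃]`. -/
abbrev CP3 : Type := ℙ ℂ (Fin 4 → ℂ)

/-- The left quaternionic projective line `ℍℙ¹`: nonzero pairs `(q₁, q₂)` of quaternions modulo
`(q₁, q₂) ∼ (p q₁, p q₂)` for nonzero `p`. It is the conformal four-sphere. -/
abbrev HP1 : Type := ℙ ℍ[ℝ] (Fin 2 → ℍ[ℝ])

/-- The quotient topology of `ℍℙ¹`. -/
instance HP1.instTopologicalSpace : TopologicalSpace HP1 :=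
  TopologicalSpace.coinduced
    (fun v : {v : Fin 2 → ℍ[ℝ] // v ≠ 0} => Projectivization.mk' ℍ[ℝ] v) inferInstance

/-- The quaternionic unit `j`. -/
def quatJ : ℍ[ℝ] := ⟨0, 0, 1, 0⟩

/-- The map `(X₀, X₁, X₂, X₃) ↦ (X₀ + X₁ j, X₂ + X₃ j)`, semilinear over `ℂ = ℂ_i ⊆ ℍ`. -/
def twistorLinear :
    (Fin 4 → ℂ) →ₛₗ[(Quaternion.ofComplex : ℂ →+* ℍ[ℝ])] (Fin 2 → ℍ[ℝ]) where
  toFun X := ![(X 0 : ℍ[ℝ]) + (X 1 : ℍ[ℝ]) * quatJ, (X 2 : ℍ[ℝ]) + (X 3 : ℍ[ℝ]) * quatJ]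
  map_add' X Y := by
    funext i
    fin_cases i <;> simp [add_mul] <;> abel
  map_smul' c X := by
    funext i
    fin_cases i <;> simp [mul_add, mul_assoc]

theorem twistorLinear_apply (X : Fin 4 → ℂ) : twistorLinear X =
    ![(X 0 : ℍ[ℝ]) + (X 1 : ℍ[ℝ]) * quatJ, (X 2 : ℍ[ℝ]) + (X 3 : ℍ[ℝ]) * quatJ] := rfl

theorem twistorLinear_injective : Function.Injective twistorLinear := by
  intro X Y h
  have h0 : (X 0 : ℍ[ℝ]) + (X 1 : ℍ[ℝ]) * quatJ = (Y 0 : ℍ[ℝ]) + (Y 1 : ℍ[ℝ]) * quatJ :=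
    congrFun h 0
  have h1 : (X 2 : ℍ[ℝ]) + (X 3 : ℍ[ℝ]) * quatJ = (Y 2 : ℍ[ℝ]) + (Y 3 : ℍ[ℝ]) * quatJ :=
    congrFun h 1
  have e : ∀ z w z' w' : ℂ, (z : ℍ[ℝ]) + (w : ℍ[ℝ]) * quatJ = (z' : ℍ[ℝ]) + (w' : ℍ[ℝ]) * quatJ →
      z = z' ∧ w = w' := by
    intro z w z' w' hzw
    have hr : quatJ.re = 0 := rfl
    have hi : quatJ.imI = 0 := rfl
    have hj : quatJ.imJ = 1 := rfl
    have hk : quatJ.imK = 0 := rfl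
    simp [Quaternion.ext_iff, Quaternion.re_mul, Quaternion.imI_mul, Quaternion.imJ_mul,
      Quaternion.imK_mul, hr, hi, hj, hk] at hzw
    exact ⟨Complex.ext hzw.1 hzw.2.1, Complex.ext hzw.2.2.1 hzw.2.2.2⟩
  have a0 := e _ _ _ _ h0
  have a1 := e _ _ _ _ h1
  funext i
  fin_cases i
  · exact a0.1
  · exact a0.2
  · exact a1.1
  · exact a1.2

/-- The twistor fibration `π [X₀, X₁, X₂, X₃] = [X₀ + X₁ j, X₂ + X₃ j]`. -/
def twistorProj : CP3 → HP1 := Projectivization.map twistorLinear twistorLinear_injective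

/-- The discriminant locus of a surface `K ⊆ ℂℙ³` of degree `d`: the points whose twistor fibre
does not meet `K` in exactly `d` points. -/
def discLocus (d : ℕ) (K : Set CP3) : Set HP1 :=
  {q | (twistorProj ⁻¹' {q} ∩ K).encard ≠ d}

/-- The set `G₀`: the points of the discriminant locus whose twistor fibre is contained in `K`. -/
def fibreLocus (d : ℕ) (K : Set CP3) : Set HP1 :=
  {q | q ∈ discLocus d K ∧ twistorProj ⁻¹' {q} ⊆ K}

/-- The set `Gₙ`, for `1 ≤ n < d`: the points whose twistor fibre meets `K` in exactly `n`
points. -/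
def countLocus (n : ℕ) (K : Set CP3) : Set HP1 :=
  {q | (twistorProj ⁻¹' {q} ∩ K).encard = n}

/-- The cubic form `X₀ X₃² + X₁² X₂`. -/
def scrollForm (X : Fin 4 → ℂ) : ℂ := X 0 * X 3 ^ 2 + X 1 ^ 2 * X 2

/-- The cubic scroll `X₀ X₃² + X₁² X₂ = 0` in `ℂℙ³`. -/
def cubicScroll : Set CP3 := {x | scrollForm x.rep = 0}

/-- Membership in the cubic scroll does not depend on the chosen homogeneous coordinates. -/
theorem mk_mem_cubicScroll (X : Fin 4 → ℂ) (hX : X ≠ 0) :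
    Projectivization.mk ℂ X hX ∈ cubicScroll ↔ scrollForm X = 0 := by
  obtain ⟨a, ha⟩ := Projectivization.exists_smul_eq_mk_rep ℂ X hX
  have h : scrollForm (Projectivization.mk ℂ X hX).rep = (a : ℂ) ^ 3 * scrollForm X := by
    rw [← ha]
    simp only [scrollForm, Pi.smul_apply, Units.smul_def, smul_eq_mul]
    ring
  simp [cubicScroll, h]

/-- The standard map of the extended plane `ℂ ∪ {∞}` to `ℍℙ¹`, `z ↦ [1, z]`, `∞ ↦ [0, 1]`; its
range is the sphere `Ĉ_i = ℂ_i ∪ {∞}`. -/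
def sphereMap : OnePoint ℂ → HP1
  | none => Projectivization.mk ℍ[ℝ] ![0, 1] (fun h => one_ne_zero (congrFun h 1))
  | some z => Projectivization.mk ℍ[ℝ] ![1, (z : ℍ[ℝ])] (fun h => one_ne_zero (congrFun h 0))

/-- The gluing relation on the disjoint union of `B` and cylinders `S¹ × [0, 1]`, one for each
`h : H`: the lower boundary circle of the cylinder `h` is collapsed to the point `p h` of `B`, and
the upper one to the point `q h`. -/
inductive PinchRel {B H : Type} (p q : H → B) :
    B ⊕ (Σ _ : H, Circle × unitInterval) → B ⊕ (Σ _ : H, Circle × unitInterval) → Prop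
  | lower (h : H) (w : Circle) : PinchRel p q (Sum.inr ⟨h, (w, 0)⟩) (Sum.inl (p h))
  | upper (h : H) (w : Circle) : PinchRel p q (Sum.inr ⟨h, (w, 1)⟩) (Sum.inl (q h))

/-- The space `B` with a handle `S¹ × [0, 1]` for each `h : H`, pinched to `B` at `p h` and `q h`,
with the quotient topology. -/
abbrev PinchedHandles {B H : Type} (p q : H → B) : Type := Quot (PinchRel p q)

/-- The inclusion of `B`. -/
def PinchedHandles.base {B H : Type} (p q : H → B) (b : B) : PinchedHandles p q :=
  Quot.mk _ (Sum.inl b)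

/-- The closed handle with index `h`, including its two attaching points. -/
def PinchedHandles.handle {B H : Type} (p q : H → B) (h : H) : Set (PinchedHandles p q) :=
  Set.range fun c : Circle × unitInterval => Quot.mk _ (Sum.inr ⟨h, c⟩)

/-- The six pairs `(P, z)` with `P ∈ {0, ∞}` and `z³ = -1`. -/
structure HandleIndex : Type where
  pole : OnePoint ℂ
  root : ℂ
  pole_eq : pole = ((0 : ℂ) : OnePoint ℂ) ∨ pole = OnePoint.infty
  root_cubed : root ^ 3 = -1

/-- The model surface: the extended plane with six handles, one pinched at `P` and `z` for each
`P ∈ {0, ∞}` and each `z` with `z³ = -1`. -/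
abbrev ModelSurface : Type :=
  PinchedHandles (fun h : HandleIndex => h.pole) (fun h : HandleIndex => (h.root : OnePoint ℂ))

/-- The inclusion of the extended plane in the model surface. -/
def modelBase : OnePoint ℂ → ModelSurface := PinchedHandles.base _ _

/-- The handle of the model surface pinched at `P` and `z`. -/
def modelHandle (h : HandleIndex) : Set ModelSurface := PinchedHandles.handle _ _ h

end

/-! ### Coordinates on the quaternionic projective line -/

/-! The fibre over `[1, u + v j]` is a projective line with coordinates `(a, b)`, on which the
scroll cuts out `a (a v + b ū)² + b² (a u - b v̄)`. If `v = 0` this is `a b² (ū² + u)`: either the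
whole fibre lies in the scroll, which happens exactly for `u = 0` or `u³ = -1`, or there are two
points. The fibre over `∞` also lies in the scroll. This accounts for the sphere and for `G₀`.

If `v ≠ 0`, then `b = 0` is not a solution, and normalizing `b = v`, `a = s` leaves the cubic `s ((s
+ ū)² + u) - |v|²`. It never has a triple root (`fibreCubic_no_triple_root`), so the fibre has two
or three points, and two exactly when there is a double root. Comparing the equations of a double
root with their conjugates solves them completely (`exists_handle_of_double_root`,
`double_root_of_handle`): with `k = |v|² / (2 |s|²)` one gets `u = z · 3k²/(1 + 2k)` with `z³ = -1`,
and `|v|` is a function of `k` vanishing for `k > 0` only at `k = 1`. The phase of `v` is free,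
since only `|v|²` enters the cubic.

For each `z` the parameter `k ∈ (0, ∞)` thus sweeps circles that shrink to `0` as `k → 0`, to `z` at
`k = 1`, and to `∞` as `k → ∞`: two pinched handles, `k < 1` and `k > 1`. They are disjoint from
each other and from the sphere away from the pinching points because `|u|` is injective in `k`. The
glued map from the model is therefore a continuous injection from a compact space to a Hausdorff
one, hence an embedding. -/

/-- The quaternion `a + b j`. -/
noncomputable def quatPair (a b : ℂ) : ℍ[ℝ] := (a : ℍ[ℝ]) + (b : ℍ[ℝ]) * quatJ

@[simp] theorem re_quatJ : quatJ.re = 0 := rfl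

@[simp] theorem imI_quatJ : quatJ.imI = 0 := rfl

@[simp] theorem imJ_quatJ : quatJ.imJ = 1 := rfl

@[simp] theorem imK_quatJ : quatJ.imK = 0 := rfl

@[simp] theorem re_quatPair (a b : ℂ) : (quatPair a b).re = a.re := by
  simp [quatPair]

@[simp] theorem imI_quatPair (a b : ℂ) : (quatPair a b).imI = a.im := by
  simp [quatPair]

@[simp] theorem imJ_quatPair (a b : ℂ) : (quatPair a b).imJ = b.re := by
  simp [quatPair]

@[simp] theorem imK_quatPair (a b : ℂ) : (quatPair a b).imK = b.im := by
  simp [quatPair]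

theorem quatPair_inj {a b c d : ℂ} : quatPair a b = quatPair c d ↔ a = c ∧ b = d := by
  simp [Complex.ext_iff, Quaternion.ext_iff, and_assoc]

theorem quatPair_surjective (q : ℍ[ℝ]) : ∃ a b : ℂ, quatPair a b = q :=
  ⟨⟨q.re, q.imI⟩, ⟨q.imJ, q.imK⟩, by ext <;> simp⟩

theorem quatPair_zero_right (a : ℂ) : quatPair a 0 = (a : ℍ[ℝ]) := by
  simp [quatPair]

theorem quatPair_mul (a b c d : ℂ) : quatPair a b * quatPair c d =
    quatPair (a * c - b * star d) (a * d + b * star c) := by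
  ext <;> simp <;> ring

theorem continuous_coeComplex : Continuous fun z : ℂ => (z : ℍ[ℝ]) :=
  LinearMap.continuous_of_finiteDimensional (Quaternion.ofComplex).toLinearMap

theorem Continuous.quatPair {X : Type*} [TopologicalSpace X] {a b : X → ℂ} (ha : Continuous a)
    (hb : Continuous b) : Continuous fun x => quatPair (a x) (b x) :=
  (continuous_coeComplex.comp ha).add ((continuous_coeComplex.comp hb).mul continuous_const)

/-- The point `[1, u + v j]`. -/
noncomputable def affinePoint (u v : ℂ) : HP1 :=
  Projectivization.mk ℍ[ℝ] ![1, quatPair u v] (fun h => one_ne_zero (congrFun h 0))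

/-- The point `[0, 1]`. -/
noncomputable def infinityPoint : HP1 :=
  Projectivization.mk ℍ[ℝ] ![0, 1] (fun h => one_ne_zero (congrFun h 1))

theorem sphereMap_coe (z : ℂ) : sphereMap (z : OnePoint ℂ) = affinePoint z 0 := by
  simp only [affinePoint, quatPair_zero_right]
  rfl

theorem sphereMap_infty : sphereMap OnePoint.infty = infinityPoint := rfl

theorem mk_eq_affinePoint_iff {w : Fin 2 → ℍ[ℝ]} (hw : w ≠ 0) (u v : ℂ) :
    Projectivization.mk ℍ[ℝ] w hw = affinePoint u v ↔ w 1 = w 0 * quatPair u v := by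
  rw [affinePoint, Projectivization.mk_eq_mk_iff']
  constructor
  · rintro ⟨a, rfl⟩
    simp
  · intro h
    refine ⟨w 0, ?_⟩
    ext i : 1
    fin_cases i <;> simp [h]

theorem mk_eq_infinityPoint_iff {w : Fin 2 → ℍ[ℝ]} (hw : w ≠ 0) :
    Projectivization.mk ℍ[ℝ] w hw = infinityPoint ↔ w 0 = 0 := by
  rw [infinityPoint, Projectivization.mk_eq_mk_iff']
  constructor
  · rintro ⟨a, rfl⟩
    simp
  · intro h
    refine ⟨w 1, ?_⟩
    ext i : 1
    fin_cases i <;> simp [h]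

theorem affinePoint_inj {u v u' v' : ℂ} :
    affinePoint u v = affinePoint u' v' ↔ u = u' ∧ v = v' := by
  conv_lhs => lhs; rw [affinePoint]
  rw [mk_eq_affinePoint_iff]
  simp [quatPair_inj]

theorem affinePoint_ne_infinityPoint (u v : ℂ) : affinePoint u v ≠ infinityPoint := by
  rw [affinePoint, ne_eq, mk_eq_infinityPoint_iff]
  simp

theorem eq_infinityPoint_or_affinePoint (x : HP1) :
    x = infinityPoint ∨ ∃ u v, x = affinePoint u v := by
  induction x using Projectivization.ind with
  | h w hw =>
    by_cases h : w 0 = 0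
    · exact Or.inl ((mk_eq_infinityPoint_iff hw).2 h)
    · obtain ⟨u, v, huv⟩ := quatPair_surjective ((w 0)⁻¹ * w 1)
      refine Or.inr ⟨u, v, (mk_eq_affinePoint_iff hw u v).2 ?_⟩
      rw [huv, mul_inv_cancel_left₀ h]

theorem sphereMap_injective : Function.Injective sphereMap := by
  intro x y h
  induction x using OnePoint.rec with
  | infty =>
    induction y using OnePoint.rec with
    | infty => rfl
    | coe z => exact absurd (h.symm.trans sphereMap_infty) (sphereMap_coe z ▸
        affinePoint_ne_infinityPoint z 0)
  | coe z =>
    induction y using OnePoint.rec with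
    | infty => exact absurd h (sphereMap_coe z ▸ affinePoint_ne_infinityPoint z 0)
    | coe z' =>
      rw [sphereMap_coe, sphereMap_coe, affinePoint_inj] at h
      rw [h.1]

theorem affinePoint_mem_range_sphereMap {u v : ℂ} :
    affinePoint u v ∈ Set.range sphereMap ↔ v = 0 := by
  constructor
  · rintro ⟨z, hz⟩
    induction z using OnePoint.rec with
    | infty => exact absurd hz.symm (affinePoint_ne_infinityPoint u v)
    | coe z =>
      rw [sphereMap_coe, affinePoint_inj] at hz
      exact hz.2.symm
  · rintro rfl
    exact ⟨u, sphereMap_coe u⟩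

/-! ### The topology of the quaternionic projective line -/

theorem continuous_projectivization_mk {X : Type*} [TopologicalSpace X] {f : X → Fin 2 → ℍ[ℝ]}
    (hf : Continuous f) (h0 : ∀ x, f x ≠ 0) :
    Continuous fun x => (Projectivization.mk ℍ[ℝ] (f x) (h0 x) : HP1) :=
  continuous_coinduced_rng.comp (hf.subtype_mk h0)

theorem normSq_add_normSq_pos {w : Fin 2 → ℍ[ℝ]} (hw : w ≠ 0) :
    0 < Quaternion.normSq (w 0) + Quaternion.normSq (w 1) := by
  have h0 := Quaternion.normSq_nonneg (a := w 0)
  have h1 := Quaternion.normSq_nonneg (a := w 1)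
  rcases h0.lt_or_eq with h | h
  · linarith
  rcases h1.lt_or_eq with h' | h'
  · linarith
  refine absurd ?_ hw
  ext i : 1
  fin_cases i
  · exact Quaternion.normSq_eq_zero.1 h.symm
  · exact Quaternion.normSq_eq_zero.1 h'.symm

/-- The Hopf map, which embeds `ℍℙ¹` in `ℍ × ℝ` as a round sphere. -/
noncomputable def hopfMap : HP1 → ℍ[ℝ] × ℝ :=
  Projectivization.lift
    (fun w => ((Quaternion.normSq (w.1 0) + Quaternion.normSq (w.1 1))⁻¹ • (star (w.1 0) * w.1 1),
      (Quaternion.normSq (w.1 0) + Quaternion.normSq (w.1 1))⁻¹ * Quaternion.normSq (w.1 0))) (by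
    rintro ⟨a, ha⟩ ⟨b, hb⟩ t h
    obtain rfl : a = t • b := h
    have ht : Quaternion.normSq t ≠ 0 := by
      rw [Quaternion.normSq_ne_zero]
      rintro rfl
      simp at ha
    have e : star (t * b 0) * (t * b 1) = Quaternion.normSq t • (star (b 0) * b 1) := by
      rw [star_mul, mul_assoc, ← mul_assoc (star t), Quaternion.star_mul_self,
        Quaternion.coe_mul_eq_smul, mul_smul_comm]
    simp only [Pi.smul_apply, smul_eq_mul, map_mul, ← mul_add, e, Prod.mk.injEq, mul_inv]
    constructor
    · rw [smul_smul]
      congr 1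
      field_simp
    · field_simp)

theorem continuous_hopfMap : Continuous hopfMap := by
  refine continuous_coinduced_dom.2 ?_
  have c (i : Fin 2) : Continuous fun w : {w : Fin 2 → ℍ[ℝ] // w ≠ 0} => w.1 i :=
    (continuous_apply i).comp continuous_subtype_val
  have n : Continuous fun w : {w : Fin 2 → ℍ[ℝ] // w ≠ 0} =>
      (Quaternion.normSq (w.1 0) + Quaternion.normSq (w.1 1))⁻¹ :=
    ((Quaternion.continuous_normSq.comp (c 0)).add (Quaternion.continuous_normSq.comp (c 1))).inv₀
      fun w => (normSq_add_normSq_pos w.2).ne'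
  exact (n.smul ((c 0).star.mul (c 1))).prodMk (n.mul (Quaternion.continuous_normSq.comp (c 0)))

theorem hopfMap_infinityPoint : hopfMap infinityPoint = (0, 0) := by
  simp [hopfMap, infinityPoint, Projectivization.lift_mk]

theorem hopfMap_affinePoint (u v : ℂ) : hopfMap (affinePoint u v) =
    ((1 + Quaternion.normSq (quatPair u v))⁻¹ • quatPair u v,
      (1 + Quaternion.normSq (quatPair u v))⁻¹) := by
  simp [hopfMap, affinePoint, Projectivization.lift_mk]

/-- The real coordinate is `0` only at `∞`; elsewhere it is the nonzero scalar by which the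
quaternion coordinate has been multiplied, so the affine coordinate can be recovered. The map serves
to show that `HP1` is Hausdorff. -/
theorem hopfMap_injective : Function.Injective hopfMap := by
  have p (q : ℍ[ℝ]) : (1 + Quaternion.normSq q)⁻¹ ≠ 0 :=
    inv_ne_zero (by linarith [Quaternion.normSq_nonneg (a := q)] : (0 : ℝ) < _).ne'
  intro x y h
  rcases eq_infinityPoint_or_affinePoint x with rfl | ⟨u, v, rfl⟩ <;>
    rcases eq_infinityPoint_or_affinePoint y with rfl | ⟨u', v', rfl⟩
  · rfl
  · rw [hopfMap_infinityPoint, hopfMap_affinePoint, Prod.mk.injEq] at h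
    exact absurd h.2.symm (p _)
  · rw [hopfMap_infinityPoint, hopfMap_affinePoint, Prod.mk.injEq] at h
    exact absurd h.2 (p _)
  · rw [hopfMap_affinePoint, hopfMap_affinePoint, Prod.mk.injEq] at h
    obtain ⟨h1, h2⟩ := h
    rw [← h2] at h1
    have := smul_right_injective ℍ[ℝ] (p (quatPair u v)) h1
    rw [affinePoint_inj]
    exact quatPair_inj.1 this

instance HP1.instT2Space : T2Space HP1 :=
  T2Space.of_injective_continuous hopfMap_injective continuous_hopfMap

theorem continuous_sphereMap : Continuous sphereMap := by
  rw [OnePoint.continuous_iff]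
  constructor
  -- In the chart at infinity `[1, z] = [z⁻¹, 1]`, and `z⁻¹ → 0` as `z → ∞`.
  · have hg : Continuous fun z : ℂ => (Projectivization.mk ℍ[ℝ] ![(z : ℍ[ℝ]), 1]
        (fun h => one_ne_zero (congrFun h 1)) : HP1) :=
      continuous_projectivization_mk (continuous_pi fun i => by
        fin_cases i
        · exact continuous_coeComplex
        · exact continuous_const) _
    have h0 := (hg.tendsto 0).comp (Filter.tendsto_inv₀_cobounded (α := ℂ))
    rw [Metric.cobounded_eq_cocompact, ← Filter.coclosedCompact_eq_cocompact] at h0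
    have e : (Projectivization.mk ℍ[ℝ] ![((0 : ℂ) : ℍ[ℝ]), 1]
        (fun h => one_ne_zero (congrFun h 1)) : HP1) = sphereMap OnePoint.infty := by
      rw [sphereMap_infty, mk_eq_infinityPoint_iff]
      simp
    rw [e] at h0
    refine h0.congr' ?_
    have : ∀ᶠ z : ℂ in Filter.coclosedCompact ℂ, z ≠ 0 := by
      rw [Filter.coclosedCompact_eq_cocompact]
      exact (isCompact_singleton (x := (0 : ℂ))).compl_mem_cocompact
    filter_upwards [this] with z hz
    rw [Function.comp_apply, sphereMap_coe, mk_eq_affinePoint_iff, quatPair_zero_right]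
    simp [← Quaternion.coeComplex_mul, hz]
  · have : (fun z : ℂ => sphereMap (z : OnePoint ℂ)) = fun z => affinePoint z 0 :=
      funext sphereMap_coe
    rw [this]
    exact continuous_projectivization_mk (continuous_pi fun i => by
      fin_cases i
      · exact continuous_const
      · exact continuous_id.quatPair continuous_const) _

theorem nonempty_range_sphereMap_homeomorph : Nonempty (Set.range sphereMap ≃ₜ
    Metric.sphere (0 : EuclideanSpace ℝ (Fin 3)) 1) :=
  ⟨(continuous_sphereMap.isClosedEmbedding sphereMap_injective).isEmbedding.toHomeomorph.symm.trans
    (onePointEquivSphereOfFinrankEq (by simp [Complex.finrank_real_complex]))⟩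

/-! ### Double roots of the cubic of a twistor fibre -/

/-- The horizontal coordinate of the handles. -/
noncomputable def handleBase (k : ℝ) : ℝ := 3 * k ^ 2 / (1 + 2 * k)

/-- The signed radius of the circles of the handles. -/
noncomputable def handleRadius (k : ℝ) : ℝ := √2 * (√k * k) * (1 - k) / (1 + 2 * k)

theorem handleBase_pos {k : ℝ} (hk : 0 < k) : 0 < handleBase k := by
  unfold handleBase
  positivity

theorem handleRadius_ne_zero {k : ℝ} (hk : 0 < k) (h1 : k ≠ 1) : handleRadius k ≠ 0 := by
  have : 1 - k ≠ 0 := sub_ne_zero.2 h1.symm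
  unfold handleRadius
  positivity

theorem handleRadius_sq {k : ℝ} (hk : 0 < k) :
    handleRadius k ^ 2 = 2 * k * (k * (1 - k) / (1 + 2 * k)) ^ 2 := by
  have h2 : √2 ^ 2 = (2 : ℝ) := Real.sq_sqrt (by norm_num)
  have hs : √k ^ 2 = k := Real.sq_sqrt hk.le
  rw [handleRadius, div_pow, mul_pow, mul_pow, mul_pow, h2, hs, div_pow]
  ring

/-- This is what lets `|u|` determine `k`. After clearing denominators the difference factors as `(k
- l)` times a positive quantity. -/
theorem handleBase_injOn : Set.InjOn handleBase (Set.Ioi 0) := by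
  intro k hk l hl h
  simp only [Set.mem_Ioi] at hk hl
  rw [handleBase, handleBase, div_eq_div_iff (by positivity) (by positivity)] at h
  have h' : (k - l) * (k + l + 2 * k * l) = 0 := by linear_combination h / 3
  rcases mul_eq_zero.1 h' with h0 | h0
  · linarith
  · have : 0 < k + l + 2 * k * l := by positivity
    exact absurd h0 this.ne'

theorem norm_eq_one_of_cube_eq_neg_one {z : ℂ} (hz : z ^ 3 = -1) : ‖z‖ = 1 := by
  have h : ‖z‖ ^ 3 = 1 := by rw [← norm_pow, hz, norm_neg, norm_one]
  exact (pow_eq_one_iff_of_nonneg (norm_nonneg z) (by norm_num)).1 h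

theorem mul_star_eq_norm_sq (z : ℂ) : z * star z = (‖z‖ : ℂ) ^ 2 := Complex.mul_conj' z

theorem mul_star_eq_one {z : ℂ} (hz : ‖z‖ = 1) : z * star z = 1 := by
  rw [mul_star_eq_norm_sq, hz]
  simp

/-- The cubic polynomial whose roots parametrize the intersection of the scroll with the twistor
fibre over `[1, u + v j]`. -/
def fibreCubic (u v s : ℂ) : ℂ := s * ((s + star u) ^ 2 + u) - v * star v

/-- The hypothesis `h'` is the vanishing of the derivative at `s`; the third root is then `-2ū -
2s`, as the roots sum to `-2ū`. -/
theorem fibreCubic_eq_of_double_root {u v s : ℂ} (h : fibreCubic u v s = 0)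
    (h' : (3 * s + star u) * (s + star u) + u = 0) (x : ℂ) :
    fibreCubic u v x = (x - s) ^ 2 * (x + 2 * star u + 2 * s) := by
  unfold fibreCubic at h ⊢
  linear_combination h + (x - s) * h'

theorem exists_fibreCubic_eq_prod (u v : ℂ) : ∃ a b c : ℂ, ∀ x,
    fibreCubic u v x = (x - a) * (x - b) * (x - c) := by
  obtain ⟨a, ha⟩ := IsAlgClosed.exists_root
    (Cubic.toPoly ⟨1, 2 * star u, star u ^ 2 + u, -(v * star v)⟩)
    (by rw [Cubic.degree_of_a_ne_zero (by simp)]; norm_num)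
  -- The quadratic quotient by `x - a`. The last root below is read off from the sum of the roots.
  obtain ⟨b, hb⟩ := IsAlgClosed.exists_root
    (Cubic.toPoly ⟨0, 1, 2 * star u + a, star u ^ 2 + u + 2 * a * star u + a ^ 2⟩)
    (by rw [Cubic.degree_of_b_ne_zero rfl (by simp)]; norm_num)
  simp only [Polynomial.IsRoot, Cubic.toPoly, Polynomial.eval_add, Polynomial.eval_mul,
    Polynomial.eval_C, Polynomial.eval_pow, Polynomial.eval_X] at ha hb
  refine ⟨a, b, -2 * star u - a - b, fun x => ?_⟩
  unfold fibreCubic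
  linear_combination ha + (x - a) * hb

/-- A double root of the cubic of a fibre with `v ≠ 0` determines a point of a handle. -/
theorem exists_handle_of_double_root {u v s : ℂ} (hv : v ≠ 0) (h : fibreCubic u v s = 0)
    (h' : (3 * s + star u) * (s + star u) + u = 0) :
    ∃ (z w : ℂ) (k : ℝ), z ^ 3 = -1 ∧ ‖w‖ = 1 ∧ 0 < k ∧ k ≠ 1 ∧
      u = z * handleBase k ∧ v = w * handleRadius k := by
  have hvv : v * star v ≠ 0 := mul_ne_zero hv (star_ne_zero.2 hv)
  have hs : s ≠ 0 := by
    rintro rfl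
    exact hvv (by simpa [fibreCubic] using h)
  have hs' : star s ≠ 0 := star_ne_zero.2 hs
  obtain ⟨k, hk, hkv⟩ : ∃ k : ℝ, 0 < k ∧ v * star v = 2 * k * (s * star s) := by
    refine ⟨‖v‖ ^ 2 / (2 * ‖s‖ ^ 2), by positivity, ?_⟩
    have : (‖s‖ : ℂ) ≠ 0 := by simpa using hs
    rw [mul_star_eq_norm_sq, mul_star_eq_norm_sq]
    push_cast
    field_simp
  have hk0 : (k : ℂ) ≠ 0 := by exact_mod_cast hk.ne'
  have hk2 : (1 + 2 * k : ℂ) ≠ 0 := by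
    have : (1 + 2 * k : ℝ) ≠ 0 := by positivity
    exact_mod_cast this
  -- The product of the roots is `|v|²`, so the third root `-2ū - 2s` equals `2k s̄ / s`.
  have e1 : s * star u = -s ^ 2 - k * star s := by
    have : 2 * s * (s * star u + s ^ 2 + k * star s) = 0 := by
      unfold fibreCubic at h
      linear_combination -h + s * h' - hkv
    rcases mul_eq_zero.1 this with h1 | h1
    · simp [hs] at h1
    · linear_combination h1
  have e2 : star s * u = -star s ^ 2 - k * s := by
    have := congrArg star e1
    simpa [Complex.conj_ofReal] using this
  have e3 : s ^ 2 * u = 2 * k * s ^ 2 * star s - k ^ 2 * star s ^ 2 := by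
    linear_combination s ^ 2 * h' - (4 * s ^ 2 + s * star u - s ^ 2 - k * star s) * e1
  -- Two expressions for `u`, from the conjugate of `e1` and from the derivative, eliminate `u`. The
  -- left side is real, so subtracting the conjugate `e5` will force `s³` to be real.
  have e4 : (1 + 2 * k) * (s ^ 2 * star s ^ 2) = k ^ 2 * star s ^ 3 - k * s ^ 3 := by
    linear_combination -star s * e3 + s ^ 2 * e2
  have e5 : (1 + 2 * k) * (s ^ 2 * star s ^ 2) = k ^ 2 * s ^ 3 - k * star s ^ 3 := by
    have := congrArg star e4
    simp only [star_mul', star_add, star_sub, star_pow, star_one, Complex.star_def,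
      Complex.conj_ofReal, Complex.conj_conj, map_ofNat] at this
    simp only [Complex.star_def]
    linear_combination this
  have e6 : s ^ 3 = star s ^ 3 := by
    have : (k * (1 + k) : ℂ) * (s ^ 3 - star s ^ 3) = 0 := by linear_combination e4 - e5
    have hk1 : (1 + k : ℂ) ≠ 0 := by
      have : (1 + k : ℝ) ≠ 0 := by positivity
      exact_mod_cast this
    rcases mul_eq_zero.1 this with h0 | h0
    · exact absurd h0 (mul_ne_zero hk0 hk1)
    · exact sub_eq_zero.1 h0
  have e7 : (1 + 2 * k) * s ^ 2 * star s ^ 2 = -(k * (1 - k)) * star s ^ 3 := by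
    linear_combination e4 - k * e6
  have e8 : (1 + 2 * k) * s ^ 2 = -(k * (1 - k)) * star s :=
    mul_right_cancel₀ (pow_ne_zero 2 hs') (by linear_combination e7)
  have hk1 : k ≠ 1 := by
    rintro rfl
    have : (1 + 2 * ((1 : ℝ) : ℂ)) * s ^ 2 = 0 := by rw [e8]; simp
    exact (mul_ne_zero hk2 (pow_ne_zero 2 hs)) this
  have hk1' : (1 - k : ℂ) ≠ 0 := by
    rw [sub_ne_zero]
    exact_mod_cast hk1.symm
  have hR : (handleRadius k : ℂ) ≠ 0 := by exact_mod_cast handleRadius_ne_zero hk hk1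
  have e9 : (1 + 2 * k) * star s ^ 2 = -(k * (1 - k)) * s := by
    have := congrArg star e8
    simpa [Complex.conj_ofReal] using this
  -- By `e8`, `s` has modulus `|k (1 - k)| / (1 + 2k)`; dividing `s̄` by the signed version of this
  -- leaves a unit, and `e9` makes its cube `-1`.
  obtain ⟨z, hsz⟩ : ∃ z : ℂ, star s * (1 + 2 * k) = z * (k * (1 - k)) :=
    ⟨star s * (1 + 2 * k) / (k * (1 - k)), by field_simp⟩
  have hz3 : z ^ 3 = -1 := by
    have n : (1 + 2 * k) ^ 2 * (s * star s) = (k * (1 - k)) ^ 2 := by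
      refine mul_right_cancel₀ (mul_ne_zero hs hs') ?_
      linear_combination (1 + 2 * k) * star s ^ 2 * e8 - (k * (1 - k)) * star s * e9
    have : (z ^ 3 + 1) * (k * (1 - k)) ^ 3 = 0 := by
      linear_combination (-(z * (k * (1 - k))) ^ 2 - (z * (k * (1 - k))) * (star s * (1 + 2 * k))
        - (star s * (1 + 2 * k)) ^ 2) * hsz + (1 + 2 * k) ^ 2 * star s * e9 - (k * (1 - k)) * n
    rcases mul_eq_zero.1 this with h0 | h0
    · linear_combination h0
    · exact absurd h0 (pow_ne_zero 3 (mul_ne_zero hk0 hk1'))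
  refine ⟨z, v / handleRadius k, k, hz3, ?_, hk, hk1, ?_, ?_⟩
  · have hn : ‖s‖ * (1 + 2 * k) = |k * (1 - k)| := by
      have := congrArg norm hsz
      rw [norm_mul, norm_mul, norm_star, norm_eq_one_of_cube_eq_neg_one hz3, one_mul] at this
      have c1 : (1 + 2 * k : ℂ) = ((1 + 2 * k : ℝ) : ℂ) := by push_cast; ring
      have c2 : (k * (1 - k) : ℂ) = ((k * (1 - k) : ℝ) : ℂ) := by push_cast; ring
      rw [c1, c2, Complex.norm_real, Complex.norm_real, Real.norm_eq_abs, Real.norm_eq_abs,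
        abs_of_pos (by positivity)] at this
      exact this
    have hvs : ‖v‖ ^ 2 = 2 * k * ‖s‖ ^ 2 := by
      rw [mul_star_eq_norm_sq, mul_star_eq_norm_sq] at hkv
      exact_mod_cast hkv
    have hvR : ‖v‖ ^ 2 = |handleRadius k| ^ 2 := by
      rw [sq_abs, handleRadius_sq hk, hvs, ← sq_abs (_ / _), abs_div, ← hn,
        abs_of_pos (by positivity : 0 < 1 + 2 * k), mul_div_assoc, div_self (by positivity),
        mul_one]
    rw [norm_div, Complex.norm_real, Real.norm_eq_abs,
      (pow_left_inj₀ (norm_nonneg v) (abs_nonneg _) two_ne_zero).1 hvR]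
    exact div_self (abs_ne_zero.2 (handleRadius_ne_zero hk hk1))
  · have : star s * ((1 + 2 * k) * u - z * (3 * k ^ 2)) = 0 := by
      refine mul_right_cancel₀ (mul_ne_zero hk0 hk1') ?_
      linear_combination (1 + 2 * k) * k * (1 - k) * e2 + star s * (3 * k ^ 2) * hsz -
        k * (1 + 2 * k) * e9
    rcases mul_eq_zero.1 this with h0 | h0
    · exact absurd h0 hs'
    · rw [handleBase]
      push_cast
      rw [← mul_div_assoc, eq_div_iff hk2]
      linear_combination h0
  · field_simp

/-- The cubic of the fibre over a point of a handle has a double root. -/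
theorem double_root_of_handle {z w : ℂ} {k : ℝ} (hz : z ^ 3 = -1) (hw : ‖w‖ = 1) (hk : 0 < k) :
    ∃ s, fibreCubic (z * handleBase k) (w * handleRadius k) s = 0 ∧
      (3 * s + star (z * handleBase k)) * (s + star (z * handleBase k)) + z * handleBase k = 0 := by
  -- Here `g = k (1 - k) / (1 + 2k)` is the signed modulus of the double root, which is `z̄ g`.
  obtain ⟨g, hg, hb, hR⟩ : ∃ g : ℝ, g * (1 + 2 * k) = k * (1 - k) ∧ handleBase k = k - g ∧
      handleRadius k ^ 2 = 2 * k * g ^ 2 := by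
    have : 1 + 2 * k ≠ 0 := by positivity
    refine ⟨_, ?_, ?_, handleRadius_sq hk⟩
    · field_simp
    · rw [handleBase]
      field_simp
      ring
  have hg' : (g * (1 + 2 * k) : ℂ) = k * (1 - k) := by exact_mod_cast hg
  have hR' : (handleRadius k : ℂ) ^ 2 = 2 * k * g ^ 2 := by exact_mod_cast hR
  have zz := mul_star_eq_one (norm_eq_one_of_cube_eq_neg_one hz)
  have ww := mul_star_eq_one hw
  have z2 : star z ^ 2 = -z := by
    linear_combination star z ^ 2 * hz - (z ^ 2 * star z + z) * zz
  have sR (x : ℝ) : star (x : ℂ) = x := Complex.conj_ofReal x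
  refine ⟨star z * g, ?_, ?_⟩
  · simp only [fibreCubic, star_mul', star_sub, hb, Complex.ofReal_sub, star_sub, sR]
    linear_combination (star z * g * k ^ 2) * z2 + (g * (k - g - k ^ 2)) * zz -
      handleRadius k ^ 2 * ww - hR' - g * hg'
  · simp only [star_mul', star_sub, hb, Complex.ofReal_sub, star_sub, sR]
    linear_combination (k * (2 * g + k)) * z2 - z * hg'

/-- Comparing coefficients gives `ū = -3a/2`, `u = 3a²/4` and `|v|² = a³`. The first two yield `ā² =
-2a`, so conjugating the third gives `|v|² = ā³ = -2|a|²`, impossible for `v ≠ 0`. -/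
theorem fibreCubic_no_triple_root {u v a : ℂ} (hv : v ≠ 0) :
    ¬ ∀ x, fibreCubic u v x = (x - a) ^ 3 := by
  intro h
  have h0 := h 0
  have h1 := h 1
  have h2 := h (-1)
  unfold fibreCubic at h0 h1 h2
  -- The values at `0`, `1`, `-1` isolate the quadratic coefficient here and the linear one next.
  have hu : star u = -(3 / 2) * a := by linear_combination (h1 + h2 - 2 * h0) / 4
  have hu' : u = 3 / 4 * a ^ 2 := by
    linear_combination (h1 - h2) / 2 - (star u - 3 / 2 * a) * hu
  have ha : star a ^ 2 = -2 * a := by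
    have := congrArg star hu'
    simp only [star_mul', star_pow, star_div₀, star_ofNat] at this
    linear_combination (4 / 3) * (hu - this)
  have hr : v * star v = a ^ 3 := by linear_combination -h0
  have hr' : v * star v + 2 * (a * star a) = 0 := by
    have := congrArg star hr
    simp only [star_mul', star_pow, star_star] at this
    linear_combination this + star a * ha
  rw [mul_star_eq_norm_sq, mul_star_eq_norm_sq] at hr'
  have : ‖v‖ ^ 2 + 2 * ‖a‖ ^ 2 = 0 := by exact_mod_cast hr'
  have hv' : 0 < ‖v‖ ^ 2 := by positivity
  nlinarith [sq_nonneg ‖a‖]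

/-! ### The twistor fibres and the cubic scroll -/

theorem twistorProj_mk_eq_affinePoint_iff {X : Fin 4 → ℂ} (hX : X ≠ 0) (u v : ℂ) :
    twistorProj (Projectivization.mk ℂ X hX) = affinePoint u v ↔
      X 2 = X 0 * u - X 1 * star v ∧ X 3 = X 0 * v + X 1 * star u := by
  rw [twistorProj, Projectivization.map_mk, mk_eq_affinePoint_iff, ← quatPair_inj, ← quatPair_mul]
  rfl

theorem twistorProj_mk_eq_infinityPoint_iff {X : Fin 4 → ℂ} (hX : X ≠ 0) :
    twistorProj (Projectivization.mk ℂ X hX) = infinityPoint ↔ X 0 = 0 ∧ X 1 = 0 := by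
  have h0 : (0 : ℍ[ℝ]) = quatPair 0 0 := by simp [quatPair_zero_right]
  rw [twistorProj, Projectivization.map_mk, mk_eq_infinityPoint_iff, ← quatPair_inj, ← h0]
  rfl

/-- Homogeneous coordinates on the twistor fibre over `[1, u + v j]`. -/
def fibreVec (u v a b : ℂ) : Fin 4 → ℂ := ![a, b, a * u - b * star v, a * v + b * star u]

theorem fibreVec_ne_zero_of_left (u v : ℂ) {a : ℂ} (b : ℂ) (ha : a ≠ 0) : fibreVec u v a b ≠ 0 :=
  fun h => ha (congrFun h 0)

theorem fibreVec_ne_zero_of_right (u v a : ℂ) {b : ℂ} (hb : b ≠ 0) : fibreVec u v a b ≠ 0 :=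
  fun h => hb (congrFun h 1)

theorem fibreVec_smul (u v c a b : ℂ) : fibreVec u v (c * a) (c * b) = c • fibreVec u v a b := by
  ext i
  fin_cases i <;> simp [fibreVec] <;> ring

theorem scrollForm_fibreVec (u v a b : ℂ) : scrollForm (fibreVec u v a b) =
    a * (a * v + b * star u) ^ 2 + b ^ 2 * (a * u - b * star v) := by
  simp [scrollForm, fibreVec]

theorem twistorProj_fibreVec (u v a b : ℂ) (h : fibreVec u v a b ≠ 0) :
    twistorProj (Projectivization.mk ℂ _ h) = affinePoint u v := by
  rw [twistorProj_mk_eq_affinePoint_iff]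
  simp [fibreVec]

theorem exists_fibreVec_of_twistorProj_eq {x : CP3} {u v : ℂ}
    (hx : twistorProj x = affinePoint u v) :
    ∃ (a b : ℂ) (h : fibreVec u v a b ≠ 0), x = Projectivization.mk ℂ _ h := by
  induction x using Projectivization.ind with
  | h X hX =>
    rw [twistorProj_mk_eq_affinePoint_iff] at hx
    have e : X = fibreVec u v (X 0) (X 1) := by
      ext i
      fin_cases i <;> simp [fibreVec, hx]
    exact ⟨X 0, X 1, e ▸ hX, by congr 1⟩

theorem fibreVec_injective (u v : ℂ) {b : ℂ} (hb : b ≠ 0) : Function.Injective fun a : ℂ =>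
    Projectivization.mk ℂ _ (fibreVec_ne_zero_of_right u v a hb) := by
  intro a a' h
  obtain ⟨c, hc⟩ := (Projectivization.mk_eq_mk_iff' ..).1 h
  have h0 : c * a' = a := congrFun hc 0
  have h1 : c * b = b := congrFun hc 1
  rw [mul_eq_right₀ hb] at h1
  rw [← h0, h1, one_mul]

theorem infinityPoint_fibre_subset : twistorProj ⁻¹' {infinityPoint} ⊆ cubicScroll := by
  intro x hx
  induction x using Projectivization.ind with
  | h X hX =>
    obtain ⟨h0, h1⟩ := (twistorProj_mk_eq_infinityPoint_iff hX).1 hx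
    rw [mk_mem_cubicScroll]
    simp [scrollForm, h0, h1]

theorem infinityPoint_fibre_infinite : (twistorProj ⁻¹' {infinityPoint}).Infinite := by
  have n (t : ℂ) : (![0, 0, t, 1] : Fin 4 → ℂ) ≠ 0 := fun h => one_ne_zero (congrFun h 3)
  refine Set.infinite_of_injective_forall_mem (f := fun t : ℂ => Projectivization.mk ℂ _ (n t))
    ?_ fun t => (twistorProj_mk_eq_infinityPoint_iff (n t)).2 ⟨rfl, rfl⟩
  intro t t' h
  obtain ⟨c, hc⟩ := (Projectivization.mk_eq_mk_iff' ..).1 h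
  have h2 : c * t' = t := congrFun hc 2
  have h3 : c * 1 = 1 := congrFun hc 3
  rw [mul_one] at h3
  rw [← h2, h3, one_mul]

theorem affinePoint_fibre_infinite (u v : ℂ) : (twistorProj ⁻¹' {affinePoint u v}).Infinite :=
  Set.infinite_of_injective_forall_mem (fibreVec_injective u v one_ne_zero)
    fun _ => twistorProj_fibreVec ..

theorem fibre_infinite (q : HP1) : (twistorProj ⁻¹' {q}).Infinite := by
  rcases eq_infinityPoint_or_affinePoint q with rfl | ⟨u, v, rfl⟩
  · exact infinityPoint_fibre_infinite
  · exact affinePoint_fibre_infinite u v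

/-- The points `(a, b) = (1, 0)` and `(1, 1)` suffice as tests: the first gives `v² = 0`, and then
the second gives `ū² + u = 0`. -/
theorem affinePoint_fibre_subset_iff (u v : ℂ) :
    twistorProj ⁻¹' {affinePoint u v} ⊆ cubicScroll ↔ v = 0 ∧ star u ^ 2 + u = 0 := by
  constructor
  · intro h
    have m (a b : ℂ) (hab : fibreVec u v a b ≠ 0) : scrollForm (fibreVec u v a b) = 0 :=
      (mk_mem_cubicScroll _ hab).1 (h (twistorProj_fibreVec u v a b hab))
    have h0 := m 1 0 (fibreVec_ne_zero_of_left _ _ _ one_ne_zero)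
    have h1 := m 1 1 (fibreVec_ne_zero_of_left _ _ _ one_ne_zero)
    rw [scrollForm_fibreVec] at h0 h1
    have hv : v = 0 := by simpa using h0
    subst hv
    refine ⟨rfl, ?_⟩
    simpa using h1
  · rintro ⟨rfl, hu⟩ x hx
    obtain ⟨a, b, h, rfl⟩ := exists_fibreVec_of_twistorProj_eq hx
    rw [mk_mem_cubicScroll, scrollForm_fibreVec, star_zero]
    linear_combination a * b ^ 2 * hu

theorem encard_fibre_of_subset {q : HP1} (h : twistorProj ⁻¹' {q} ⊆ cubicScroll) :
    (twistorProj ⁻¹' {q} ∩ cubicScroll).encard = ⊤ := by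
  rw [Set.inter_eq_left.2 h, (fibre_infinite q).encard_eq]

theorem encard_fibre_of_eq_zero {u : ℂ} (hu : star u ^ 2 + u ≠ 0) :
    (twistorProj ⁻¹' {affinePoint u 0} ∩ cubicScroll).encard = 2 := by
  have n1 := fibreVec_ne_zero_of_left u 0 0 one_ne_zero
  have n2 := fibreVec_ne_zero_of_right u 0 0 one_ne_zero
  have : twistorProj ⁻¹' {affinePoint u 0} ∩ cubicScroll =
      {Projectivization.mk ℂ _ n1, Projectivization.mk ℂ _ n2} := by
    ext x
    constructor
    · rintro ⟨hx, hx'⟩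
      obtain ⟨a, b, h, rfl⟩ := exists_fibreVec_of_twistorProj_eq hx
      rw [mk_mem_cubicScroll, scrollForm_fibreVec, star_zero] at hx'
      have : a * (b ^ 2 * (star u ^ 2 + u)) = 0 := by linear_combination hx'
      rcases mul_eq_zero.1 this with rfl | h0
      · right
        rw [Set.mem_singleton_iff, Projectivization.mk_eq_mk_iff']
        exact ⟨b, by rw [← fibreVec_smul, mul_zero, mul_one]⟩
      · rcases mul_eq_zero.1 h0 with h1 | h1
        · obtain rfl := pow_eq_zero_iff two_ne_zero |>.1 h1
          left
          rw [Projectivization.mk_eq_mk_iff']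
          exact ⟨a, by rw [← fibreVec_smul, mul_zero, mul_one]⟩
        · exact absurd h1 hu
    · rintro (rfl | rfl) <;>
        refine ⟨twistorProj_fibreVec .., ?_⟩ <;>
        rw [mk_mem_cubicScroll, scrollForm_fibreVec] <;> simp
  rw [this, Set.encard_pair]
  rw [ne_eq, Projectivization.mk_eq_mk_iff']
  rintro ⟨c, hc⟩
  have h0 : c * 0 = 1 := congrFun hc 0
  simp at h0

/-- For `b = 0` the form is `a³ v²`, so every intersection point has `b ≠ 0` and can be scaled to `b
= v`, where the form becomes `v²` times the cubic in `s = a`. -/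
theorem encard_fibre_of_ne_zero (u : ℂ) {v : ℂ} (hv : v ≠ 0) :
    (twistorProj ⁻¹' {affinePoint u v} ∩ cubicScroll).encard =
      {s | fibreCubic u v s = 0}.encard := by
  rw [← (fibreVec_injective u v hv).encard_image]
  congr 1
  have key (s : ℂ) : scrollForm (fibreVec u v s v) = v ^ 2 * fibreCubic u v s := by
    rw [scrollForm_fibreVec, fibreCubic]
    ring
  ext x
  constructor
  · rintro ⟨hx, hx'⟩
    obtain ⟨a, b, h, rfl⟩ := exists_fibreVec_of_twistorProj_eq hx
    rw [mk_mem_cubicScroll] at hx'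
    have hb : b ≠ 0 := by
      rintro rfl
      rw [scrollForm_fibreVec] at hx'
      have ha : a = 0 := by simpa [hv] using hx'
      exact h (by ext i; fin_cases i <;> simp [fibreVec, ha])
    have e : fibreVec u v a b = (b / v) • fibreVec u v (a * v / b) v := by
      rw [← fibreVec_smul]
      congr 1 <;> field_simp
    refine ⟨a * v / b, ?_, ?_⟩
    · have := (mk_mem_cubicScroll _ (fibreVec_ne_zero_of_right u v (a * v / b) hv)).1 (by
        rwa [← mk_mem_cubicScroll _ h, (Projectivization.mk_eq_mk_iff' ..).2 ⟨b / v, e.symm⟩] at hx')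
      rw [key] at this
      exact (mul_eq_zero.1 this).resolve_left (pow_ne_zero 2 hv)
    · exact ((Projectivization.mk_eq_mk_iff' ..).2 ⟨b / v, e.symm⟩).symm
  · rintro ⟨s, hs, rfl⟩
    refine ⟨twistorProj_fibreVec .., ?_⟩
    rw [mk_mem_cubicScroll, key, hs, mul_zero]

theorem encard_fibre_eq_two_or_three (u : ℂ) {v : ℂ} (hv : v ≠ 0) :
    (twistorProj ⁻¹' {affinePoint u v} ∩ cubicScroll).encard = 2 ∨
      (twistorProj ⁻¹' {affinePoint u v} ∩ cubicScroll).encard = 3 := by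
  rw [encard_fibre_of_ne_zero u hv]
  obtain ⟨a, b, c, h⟩ := exists_fibreCubic_eq_prod u v
  have e : {s | fibreCubic u v s = 0} = {a, b, c} := by
    ext s
    simp [h, sub_eq_zero, or_assoc]
  rw [e]
  have triple (h1 : a = b) (h2 : a = c) : False := by
    subst h1 h2
    exact fibreCubic_no_triple_root hv fun x => by rw [h]; ring
  by_cases hab : a = b
  · subst hab
    exact Or.inl (by rw [Set.insert_eq_of_mem (by simp), Set.encard_pair (triple rfl)])
  by_cases hac : a = c
  · subst hac
    exact Or.inl (by rw [Set.insert_eq_of_mem (by simp), Set.encard_pair (Ne.symm hab)])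
  by_cases hbc : b = c
  · subst hbc
    exact Or.inl (by rw [Set.pair_eq_singleton, Set.encard_pair hab])
  · exact Or.inr (Set.encard_eq_three.2 ⟨a, b, c, hab, hac, hbc, rfl⟩)

theorem encard_fibre_eq_two_iff {u v : ℂ} (hv : v ≠ 0) :
    (twistorProj ⁻¹' {affinePoint u v} ∩ cubicScroll).encard = 2 ↔
      ∃ (z w : ℂ) (k : ℝ), z ^ 3 = -1 ∧ ‖w‖ = 1 ∧ 0 < k ∧ k ≠ 1 ∧
        u = z * handleBase k ∧ v = w * handleRadius k := by
  rw [encard_fibre_of_ne_zero u hv]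
  constructor
  · intro h2
    obtain ⟨a, b, c, h⟩ := exists_fibreCubic_eq_prod u v
    have e : {s | fibreCubic u v s = 0} = {a, b, c} := by
      ext s
      simp [h, sub_eq_zero, or_assoc]
    obtain ⟨s, t, hst⟩ : ∃ s t, ∀ x, fibreCubic u v x = (x - s) ^ 2 * (x - t) := by
      by_cases hab : a = b
      · exact ⟨a, c, fun x => by rw [h, hab]; ring⟩
      by_cases hac : a = c
      · exact ⟨a, b, fun x => by rw [h, hac]; ring⟩
      by_cases hbc : b = c
      · exact ⟨b, a, fun x => by rw [h, hbc]; ring⟩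
      rw [e, Set.encard_eq_three.2 ⟨a, b, c, hab, hac, hbc, rfl⟩] at h2
      exact absurd h2 (by decide)
    refine exists_handle_of_double_root (s := s) hv (by rw [hst]; ring) ?_
    have h0 := hst 0
    have h1 := hst 1
    have h3 := hst (-1)
    unfold fibreCubic at h0 h1 h3
    -- The values at `0`, `1`, `-1` give the linear and quadratic coefficients, hence the derivative
    -- at `s`.
    linear_combination (h1 - h3) / 2 + s * (h1 + h3 - 2 * h0)
  · rintro ⟨z, w, k, hz, hw, hk, -, rfl, rfl⟩
    obtain ⟨s, h, h'⟩ := double_root_of_handle hz hw hk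
    have hx := fibreCubic_eq_of_double_root h h'
    have h3 := encard_fibre_eq_two_or_three (z * handleBase k) hv
    rw [encard_fibre_of_ne_zero _ hv] at h3
    refine h3.resolve_right fun h3 => ?_
    have sub : {x | fibreCubic (z * handleBase k) (w * handleRadius k) x = 0} ⊆
        {s, -2 * star (z * (handleBase k : ℂ)) - 2 * s} := by
      intro x hx0
      rw [Set.mem_ofPred_eq, hx] at hx0
      rcases mul_eq_zero.1 hx0 with h0 | h0
      · exact Or.inl (sub_eq_zero.1 (pow_eq_zero_iff two_ne_zero |>.1 h0))
      · exact Or.inr (by rw [Set.mem_singleton_iff]; linear_combination h0)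
    have := (Set.encard_le_encard sub).trans (Set.encard_insert_le _ _)
    rw [h3, Set.encard_singleton] at this
    exact absurd this (by decide)

/-! ### Maps out of a space with pinched handles -/

namespace PinchedHandles

variable {B H Y : Type} {p q : H → B}

/-- The map induced by maps of the base and of the cylinders that agree on the boundary circles. -/
def lift (f : B → Y) (g : H → Circle × unitInterval → Y) (h0 : ∀ h w, g h (w, 0) = f (p h))
    (h1 : ∀ h w, g h (w, 1) = f (q h)) : PinchedHandles p q → Y :=
  Quot.lift (Sum.elim f fun c => g c.1 c.2) (by
    rintro _ _ (⟨h, w⟩ | ⟨h, w⟩)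
    · exact h0 h w
    · exact h1 h w)

theorem image_lift_handle (f : B → Y) (g : H → Circle × unitInterval → Y)
    (h0 : ∀ h w, g h (w, 0) = f (p h)) (h1 : ∀ h w, g h (w, 1) = f (q h)) (h : H) :
    lift f g h0 h1 '' handle p q h = Set.range (g h) := by
  rw [handle, ← Set.range_comp]
  rfl

theorem continuous_lift [TopologicalSpace B] [TopologicalSpace Y] {f : B → Y}
    {g : H → Circle × unitInterval → Y}
    (h0 : ∀ h w, g h (w, 0) = f (p h)) (h1 : ∀ h w, g h (w, 1) = f (q h)) (hf : Continuous f)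
    (hg : ∀ h, Continuous (g h)) : Continuous (lift f g h0 h1) :=
  continuous_quot_lift _ (hf.sumElim (continuous_sigma hg))

theorem eq_base_or_eq_handle (x : PinchedHandles p q) : (∃ b, x = base p q b) ∨
    ∃ (h : H) (w : Circle) (t : unitInterval), t ≠ 0 ∧ t ≠ 1 ∧
      x = Quot.mk _ (Sum.inr ⟨h, (w, t)⟩) := by
  induction x using Quot.ind with
  | mk a =>
    obtain b | ⟨h, w, t⟩ := a
    · exact Or.inl ⟨b, rfl⟩
    by_cases t0 : t = 0
    · subst t0
      exact Or.inl ⟨p h, Quot.sound (PinchRel.lower h w)⟩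
    by_cases t1 : t = 1
    · subst t1
      exact Or.inl ⟨q h, Quot.sound (PinchRel.upper h w)⟩
    · exact Or.inr ⟨h, w, t, t0, t1, rfl⟩

/-- The quotient is covered by the base and the open cylinders, so no description of the generated
equivalence relation is needed. -/
theorem lift_injective {f : B → Y} {g : H → Circle × unitInterval → Y}
    (h0 : ∀ h w, g h (w, 0) = f (p h)) (h1 : ∀ h w, g h (w, 1) = f (q h))
    (hf : Function.Injective f)
    (hfg : ∀ h w t, t ≠ 0 → t ≠ 1 → g h (w, t) ∉ Set.range f)
    (hg : ∀ h w t h' w' t', t ≠ 0 → t ≠ 1 → t' ≠ 0 → t' ≠ 1 → g h (w, t) = g h' (w', t') →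
      h = h' ∧ w = w' ∧ t = t') : Function.Injective (lift f g h0 h1) := by
  intro x y hxy
  rcases eq_base_or_eq_handle x with ⟨b, rfl⟩ | ⟨h, w, t, t0, t1, rfl⟩ <;>
    rcases eq_base_or_eq_handle y with ⟨b', rfl⟩ | ⟨h', w', t', t0', t1', rfl⟩
  · rw [hf hxy]
  · exact absurd ⟨b, hxy⟩ (hfg h' w' t' t0' t1')
  · exact absurd ⟨b', hxy.symm⟩ (hfg h w t t0 t1)
  · obtain ⟨rfl, rfl, rfl⟩ := hg h w t h' w' t' t0 t1 t0' t1' hxy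
    rfl

end PinchedHandles

/-! ### The handles of the discriminant locus -/

theorem cube_eq_neg_one_iff {z : ℂ} : z ^ 3 = -1 ↔ z = -1 ∨
    z = 1 / 2 + Complex.I * (√3 / 2) ∨ z = 1 / 2 - Complex.I * (√3 / 2) := by
  have h3 : (√3 : ℂ) ^ 2 = 3 := by
    exact_mod_cast Real.sq_sqrt (by norm_num : (0 : ℝ) ≤ 3)
  have e : z ^ 3 + 1 = (z + 1) * ((z - (1 / 2 + Complex.I * (√3 / 2))) *
      (z - (1 / 2 - Complex.I * (√3 / 2)))) := by
    linear_combination (-(z + 1) / 4) * h3 + (z + 1) * √3 ^ 2 / 4 * Complex.I_sq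
  rw [← sub_eq_zero (b := (-1 : ℂ)), sub_neg_eq_add, e, mul_eq_zero, mul_eq_zero, sub_eq_zero,
    sub_eq_zero, add_eq_zero_iff_eq_neg]

/-- Finiteness makes the disjoint union of the cylinders, and with it the model surface, compact. -/
instance HandleIndex.instFinite : Finite HandleIndex := by
  have hf : {z : ℂ | z ^ 3 = -1}.Finite := by
    have : {z : ℂ | z ^ 3 = -1} =
        {-1, 1 / 2 + Complex.I * (√3 / 2), 1 / 2 - Complex.I * (√3 / 2)} := by
      ext z
      exact cube_eq_neg_one_iff
    rw [this]
    exact Set.toFinite _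
  have hp : ({((0 : ℂ) : OnePoint ℂ), OnePoint.infty} : Set (OnePoint ℂ)).Finite := Set.toFinite _
  have := (hp.prod hf).to_subtype
  refine Finite.of_injective (β := ({((0 : ℂ) : OnePoint ℂ), OnePoint.infty} ×ˢ
    {z : ℂ | z ^ 3 = -1} : Set (OnePoint ℂ × ℂ)))
    (fun h => ⟨(h.pole, h.root), h.pole_eq, h.root_cubed⟩) ?_
  rintro ⟨a, b, _, _⟩ ⟨c, d, _, _⟩ h
  obtain ⟨rfl, rfl⟩ := Prod.mk.inj (Subtype.mk.inj h)
  rfl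

instance ModelSurface.instCompactSpace : CompactSpace ModelSurface := by
  unfold ModelSurface PinchedHandles
  infer_instance

/-- The point with parameter `k` of the meridian with phase `w` over the ray through `z`. -/
noncomputable def handlePoint (z w : ℂ) (k : ℝ) : HP1 :=
  affinePoint (z * handleBase k) (w * handleRadius k)

theorem handlePoint_one (z w : ℂ) : handlePoint z w 1 = sphereMap (z : OnePoint ℂ) := by
  rw [sphereMap_coe, handlePoint]
  congr 1
  · norm_num [handleBase]
  · simp [handleRadius]

theorem handlePoint_zero (z w : ℂ) : handlePoint z w 0 = sphereMap ((0 : ℂ) : OnePoint ℂ) := by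
  rw [sphereMap_coe, handlePoint]
  congr 1 <;> simp [handleBase, handleRadius]

theorem handlePoint_inj {z w z' w' : ℂ} {k k' : ℝ} (hz : ‖z‖ = 1) (hz' : ‖z'‖ = 1)
    (hk : 0 < k) (hk1 : k ≠ 1) (hk' : 0 < k') (h : handlePoint z w k = handlePoint z' w' k') :
    z = z' ∧ w = w' ∧ k = k' := by
  obtain ⟨h1, h2⟩ := affinePoint_inj.1 h
  have hA := handleBase_pos hk
  have hn := congrArg norm h1
  rw [norm_mul, norm_mul, hz, hz', one_mul, one_mul, Complex.norm_real, Complex.norm_real,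
    Real.norm_of_nonneg hA.le, Real.norm_of_nonneg (handleBase_pos hk').le] at hn
  obtain rfl := handleBase_injOn hk hk' hn
  refine ⟨mul_right_cancel₀ ?_ h1, mul_right_cancel₀ ?_ h2, rfl⟩
  · exact_mod_cast hA.ne'
  · exact_mod_cast handleRadius_ne_zero hk hk1

theorem handlePoint_notMem_range_sphereMap (z : ℂ) {w : ℂ} {k : ℝ} (hw : ‖w‖ = 1) (hk : 0 < k)
    (hk1 : k ≠ 1) : handlePoint z w k ∉ Set.range sphereMap := by
  rw [handlePoint, affinePoint_mem_range_sphereMap]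
  have hw0 : w ≠ 0 := norm_ne_zero_iff.1 (by rw [hw]; exact one_ne_zero)
  exact mul_ne_zero hw0 (by exact_mod_cast handleRadius_ne_zero hk hk1)

theorem quatPair_ofReal_mul (r : ℝ) (a b : ℂ) :
    quatPair r 0 * quatPair a b = quatPair (r * a) (r * b) := by
  rw [quatPair_mul]
  simp

/-- Homogeneous coordinates of the handles that are pinched at `0`. -/
noncomputable def innerVec (z w : ℂ) (t : ℝ) : Fin 2 → ℍ[ℝ] :=
  ![quatPair ((1 + 2 * t : ℝ) : ℂ) 0,
    quatPair (z * (3 * t ^ 2 : ℝ)) (w * (√2 * (√t * t) * (1 - t) : ℝ))]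

/-- Homogeneous coordinates of the handles that are pinched at `∞`. -/
noncomputable def outerVec (z w : ℂ) (t : ℝ) : Fin 2 → ℍ[ℝ] :=
  ![quatPair ((√t * t * (t + 2) : ℝ) : ℂ) 0,
    quatPair (z * (3 * √t : ℝ)) (w * (√2 * (t - 1) : ℝ))]

theorem innerVec_ne_zero (z w : ℂ) {t : ℝ} (ht : 0 ≤ t) : innerVec z w t ≠ 0 := by
  intro h
  have h0 : quatPair ((1 + 2 * t : ℝ) : ℂ) 0 = 0 := congrFun h 0
  have : 1 + 2 * t = 0 := by simpa using congrArg QuaternionAlgebra.re h0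
  linarith

theorem outerVec_ne_zero (z : ℂ) {w : ℂ} (hw : w ≠ 0) {t : ℝ} (ht : 0 ≤ t) :
    outerVec z w t ≠ 0 := by
  intro h
  have hz : (0 : ℍ[ℝ]) = quatPair 0 0 := by simp [quatPair_zero_right]
  have h0 : quatPair ((√t * t * (t + 2) : ℝ) : ℂ) 0 = quatPair 0 0 := hz ▸ congrFun h 0
  have h1 : quatPair (z * (3 * √t : ℝ)) (w * (√2 * (t - 1) : ℝ)) = quatPair 0 0 :=
    hz ▸ congrFun h 1
  have e1 := (mul_eq_zero.1 (quatPair_inj.1 h1).2).resolve_left hw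
  have e1' : √2 * (t - 1) = 0 := by exact_mod_cast e1
  have : t = 1 := by
    rcases mul_eq_zero.1 e1' with h | h
    · simp at h
    · linarith
  subst this
  have e0 : (√1 * 1 * (1 + 2) : ℝ) = 0 := by exact_mod_cast (quatPair_inj.1 h0).1
  norm_num at e0

theorem mk_innerVec (z w : ℂ) {t : ℝ} (ht : 0 ≤ t) :
    Projectivization.mk ℍ[ℝ] _ (innerVec_ne_zero z w ht) = handlePoint z w t := by
  have : 1 + 2 * t ≠ 0 := by positivity
  rw [handlePoint, mk_eq_affinePoint_iff]
  change quatPair _ _ = quatPair _ _ * _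
  rw [quatPair_ofReal_mul, quatPair_inj]
  constructor
  · rw [mul_left_comm, ← Complex.ofReal_mul, handleBase, mul_div_cancel₀ _ this]
  · rw [mul_left_comm _ w, ← Complex.ofReal_mul, handleRadius, mul_div_cancel₀ _ this]

/-- `outerVec` comes from substituting `k = t⁻¹` and multiplying by `√t · t · (t + 2)`, which clears
the denominators and extends continuously to `t = 0`. -/
theorem mk_outerVec (z : ℂ) {w : ℂ} (hw : w ≠ 0) {t : ℝ} (ht : 0 < t) :
    Projectivization.mk ℍ[ℝ] _ (outerVec_ne_zero z hw ht.le) = handlePoint z w t⁻¹ := by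
  have hs : √t ≠ 0 := (Real.sqrt_pos.2 ht).ne'
  have hs2 : √t ^ 2 = t := Real.sq_sqrt ht.le
  have h2 : t + 2 ≠ 0 := by positivity
  rw [handlePoint, mk_eq_affinePoint_iff]
  change quatPair _ _ = quatPair _ _ * _
  rw [quatPair_ofReal_mul, quatPair_inj]
  constructor
  · rw [mul_left_comm, ← Complex.ofReal_mul, handleBase]
    congr 2
    field_simp
  · rw [mul_left_comm, ← Complex.ofReal_mul, handleRadius, Real.sqrt_inv]
    congr 2
    field_simp

theorem mk_outerVec_zero (z : ℂ) {w : ℂ} (hw : w ≠ 0) :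
    Projectivization.mk ℍ[ℝ] _ (outerVec_ne_zero z hw le_rfl) = sphereMap OnePoint.infty := by
  rw [sphereMap_infty, mk_eq_infinityPoint_iff]
  simp [outerVec, quatPair_zero_right]

open Classical in
/-- The parametrization of the handles of the discriminant locus. -/
noncomputable def handleMap (h : HandleIndex) (c : Circle × unitInterval) : HP1 :=
  if h.pole = OnePoint.infty then
    Projectivization.mk ℍ[ℝ] _ (outerVec_ne_zero h.root (Circle.coe_ne_zero c.1) c.2.2.1)
  else Projectivization.mk ℍ[ℝ] _ (innerVec_ne_zero h.root c.1 c.2.2.1)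

theorem continuous_handleMap (h : HandleIndex) : Continuous (handleMap h) := by
  have hw : Continuous fun c : Circle × unitInterval => (c.1 : ℂ) :=
    continuous_subtype_val.comp continuous_fst
  have ht : Continuous fun c : Circle × unitInterval => (c.2 : ℝ) :=
    continuous_subtype_val.comp continuous_snd
  have cR {f : Circle × unitInterval → ℝ} (hf : Continuous f) :
      Continuous fun c => (f c : ℂ) := Complex.continuous_ofReal.comp hf
  unfold handleMap
  split_ifs
  · refine continuous_projectivization_mk (continuous_pi fun i => ?_) _
    fin_cases i
    · exact (cR (by fun_prop)).quatPair continuous_const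
    · exact (continuous_const.mul (cR (by fun_prop))).quatPair (hw.mul (cR (by fun_prop)))
  · refine continuous_projectivization_mk (continuous_pi fun i => ?_) _
    fin_cases i
    · exact (cR (by fun_prop)).quatPair continuous_const
    · exact (continuous_const.mul (cR (by fun_prop))).quatPair (hw.mul (cR (by fun_prop)))

/-- The parameter of `handlePoint` along a handle. -/
noncomputable def HandleIndex.param (h : HandleIndex) (t : ℝ) : ℝ :=
  open Classical in if h.pole = OnePoint.infty then t⁻¹ else t

/-- At `t = 0` this fails for the handles at `∞`: the convention `0⁻¹ = 0` would give the point `0`.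
-/
theorem handleMap_eq (h : HandleIndex) (w : Circle) {t : unitInterval} (ht : t ≠ 0) :
    handleMap h (w, t) = handlePoint h.root w (h.param t) := by
  have ht' : (0 : ℝ) < t := unitInterval.pos_iff_ne_zero.2 ht
  unfold handleMap HandleIndex.param
  split_ifs
  · exact mk_outerVec h.root (Circle.coe_ne_zero w) ht'
  · exact mk_innerVec h.root w t.2.1

theorem HandleIndex.param_pos (h : HandleIndex) {t : ℝ} (ht : 0 < t) : 0 < h.param t := by
  unfold HandleIndex.param
  split_ifs <;> positivity

theorem HandleIndex.param_eq_one_iff (h : HandleIndex) {t : ℝ} : h.param t = 1 ↔ t = 1 := by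
  unfold HandleIndex.param
  split_ifs <;> simp

theorem handleMap_zero (h : HandleIndex) (w : Circle) : handleMap h (w, 0) = sphereMap h.pole := by
  unfold handleMap
  split_ifs with hp
  · rw [hp]
    exact mk_outerVec_zero h.root (Circle.coe_ne_zero w)
  · rw [h.pole_eq.resolve_right hp, ← handlePoint_zero h.root w]
    exact mk_innerVec h.root w le_rfl

theorem handleMap_one (h : HandleIndex) (w : Circle) :
    handleMap h (w, 1) = sphereMap (h.root : OnePoint ℂ) := by
  rw [handleMap_eq h w one_ne_zero, Set.Icc.coe_one, h.param_eq_one_iff.2 rfl, handlePoint_one]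

theorem handleMap_notMem_range_sphereMap (h : HandleIndex) (w : Circle) (t : unitInterval)
    (t0 : t ≠ 0) (t1 : t ≠ 1) : handleMap h (w, t) ∉ Set.range sphereMap := by
  rw [handleMap_eq h w t0]
  refine handlePoint_notMem_range_sphereMap _ (Circle.norm_coe w)
    (h.param_pos (unitInterval.pos_iff_ne_zero.2 t0)) fun h1 => t1 (Subtype.ext ?_)
  exact h.param_eq_one_iff.1 h1

/-- The side of `1` on which the parameter lies tells the two poles apart. -/
theorem HandleIndex.param_inj {h h' : HandleIndex} {t t' : ℝ} (ht : 0 < t) (ht1 : t < 1)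
    (ht' : 0 < t') (ht1' : t' < 1) (e : h.param t = h'.param t') : h.pole = h'.pole ∧ t = t' := by
  unfold HandleIndex.param at e
  split_ifs at e with hp hp' hp'
  · exact ⟨hp.trans hp'.symm, inv_injective e⟩
  · exact absurd e ((ht1'.trans ((one_lt_inv₀ ht).2 ht1)).ne')
  · exact absurd e ((ht1.trans ((one_lt_inv₀ ht').2 ht1')).ne)
  · exact ⟨(h.pole_eq.resolve_right hp).trans (h'.pole_eq.resolve_right hp').symm, e⟩

theorem handleMap_inj (h : HandleIndex) (w : Circle) (t : unitInterval) (h' : HandleIndex)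
    (w' : Circle) (t' : unitInterval) (t0 : t ≠ 0) (t1 : t ≠ 1) (t0' : t' ≠ 0) (t1' : t' ≠ 1)
    (e : handleMap h (w, t) = handleMap h' (w', t')) : h = h' ∧ w = w' ∧ t = t' := by
  rw [handleMap_eq h w t0, handleMap_eq h' w' t0'] at e
  have p := unitInterval.pos_iff_ne_zero.2 t0
  have p' := unitInterval.pos_iff_ne_zero.2 t0'
  obtain ⟨hz, hw, hk⟩ := handlePoint_inj (norm_eq_one_of_cube_eq_neg_one h.root_cubed)
    (norm_eq_one_of_cube_eq_neg_one h'.root_cubed) (h.param_pos p)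
    (fun h1 => t1 (Subtype.ext (h.param_eq_one_iff.1 h1))) (h'.param_pos p') e
  obtain ⟨hp, ht⟩ := HandleIndex.param_inj p (unitInterval.lt_one_iff_ne_one.2 t1) p'
    (unitInterval.lt_one_iff_ne_one.2 t1') hk
  refine ⟨?_, Circle.ext hw, Subtype.ext ht⟩
  obtain ⟨a, b, _, _⟩ := h
  obtain ⟨c, d, _, _⟩ := h'
  obtain rfl : a = c := hp
  obtain rfl : b = d := hz
  rfl

/-- Every point of a meridian with `k ≠ 1` lies on a handle. -/
theorem handlePoint_mem_range_handleMap {z w : ℂ} {k : ℝ} (hz : z ^ 3 = -1) (hw : ‖w‖ = 1)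
    (hk : 0 < k) : ∃ h c, handleMap h c = handlePoint z w k := by
  let w' : Circle := ⟨w, mem_sphere_zero_iff_norm.2 hw⟩
  rcases le_total k 1 with h1 | h1
  · let t : unitInterval := ⟨k, hk.le, h1⟩
    have t0 : t ≠ 0 := unitInterval.pos_iff_ne_zero.1 hk
    refine ⟨⟨((0 : ℂ) : OnePoint ℂ), z, Or.inl rfl, hz⟩, (w', t), ?_⟩
    rw [handleMap_eq _ _ t0, HandleIndex.param, if_neg (OnePoint.coe_ne_infty 0)]
  · have hk' : 0 < k⁻¹ := inv_pos.2 hk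
    let t : unitInterval := ⟨k⁻¹, hk'.le, inv_le_one_of_one_le₀ h1⟩
    have t0 : t ≠ 0 := unitInterval.pos_iff_ne_zero.1 hk'
    refine ⟨⟨OnePoint.infty, z, Or.inr rfl, hz⟩, (w', t), ?_⟩
    rw [handleMap_eq _ _ t0, HandleIndex.param, if_pos rfl]
    simp only [t, inv_inv]
    rfl

/-- The embedding of the model surface in `ℍℙ¹`. -/
noncomputable def modelMap : ModelSurface → HP1 :=
  PinchedHandles.lift sphereMap handleMap handleMap_zero handleMap_one

theorem isEmbedding_modelMap : Topology.IsEmbedding modelMap :=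
  ((PinchedHandles.continuous_lift _ _ continuous_sphereMap
    continuous_handleMap).isClosedEmbedding
      (PinchedHandles.lift_injective _ _ sphereMap_injective handleMap_notMem_range_sphereMap
        handleMap_inj)).isEmbedding

/-! ### The discriminant locus -/

theorem mem_discLocus_of_mem_range_sphereMap {q : HP1} (hq : q ∈ Set.range sphereMap) :
    q ∈ discLocus 3 cubicScroll := by
  change Set.encard _ ≠ _
  obtain ⟨z, rfl⟩ := hq
  induction z using OnePoint.rec with
  | infty =>
    rw [sphereMap_infty, encard_fibre_of_subset infinityPoint_fibre_subset]
    exact fun h => absurd h (by decide)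
  | coe z =>
    rw [sphereMap_coe]
    by_cases hz : star z ^ 2 + z = 0
    · rw [encard_fibre_of_subset ((affinePoint_fibre_subset_iff z 0).2 ⟨rfl, hz⟩)]
      exact fun h => absurd h (by decide)
    · rw [encard_fibre_of_eq_zero hz]
      exact fun h => absurd h (by decide)

theorem discLocus_cubicScroll :
    discLocus 3 cubicScroll = Set.range sphereMap ∪ ⋃ h, Set.range (handleMap h) := by
  ext q
  constructor
  · intro hq
    rcases eq_infinityPoint_or_affinePoint q with rfl | ⟨u, v, rfl⟩
    · exact Or.inl ⟨_, sphereMap_infty⟩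
    by_cases hv : v = 0
    · exact Or.inl (affinePoint_mem_range_sphereMap.2 hv)
    obtain ⟨z, w, k, hz, hw, hk, -, rfl, rfl⟩ := (encard_fibre_eq_two_iff hv).1
      ((encard_fibre_eq_two_or_three u hv).resolve_right hq)
    exact Or.inr (Set.mem_iUnion.2 (handlePoint_mem_range_handleMap hz hw hk))
  · rintro (hq | hq)
    · exact mem_discLocus_of_mem_range_sphereMap hq
    obtain ⟨h, ⟨w, t⟩, rfl⟩ := Set.mem_iUnion.1 hq
    by_cases t0 : t = 0
    · subst t0
      exact mem_discLocus_of_mem_range_sphereMap ⟨_, (handleMap_zero h w).symm⟩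
    by_cases t1 : t = 1
    · subst t1
      exact mem_discLocus_of_mem_range_sphereMap ⟨_, (handleMap_one h w).symm⟩
    have hm := handleMap_notMem_range_sphereMap h w t t0 t1
    rw [handleMap_eq h w t0, handlePoint, affinePoint_mem_range_sphereMap] at hm
    rw [handleMap_eq h w t0, handlePoint]
    change Set.encard _ ≠ _
    rw [(encard_fibre_eq_two_iff hm).2 ⟨h.root, w, h.param t, h.root_cubed, Circle.norm_coe w,
      h.param_pos (unitInterval.pos_iff_ne_zero.2 t0),
      fun h1 => t1 (Subtype.ext (h.param_eq_one_iff.1 h1)), rfl, rfl⟩]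
    exact fun h => absurd h (by decide)

/-- For `u ≠ 0` either side forces `|u| = 1`, so `ū = u⁻¹` and `ū² + u = (1 + u³) / u²`. -/
theorem star_sq_add_self_eq_zero_iff {u : ℂ} : star u ^ 2 + u = 0 ↔ u = 0 ∨ u ^ 3 = -1 := by
  constructor
  · intro h
    by_cases hu : u = 0
    · exact Or.inl hu
    right
    have hn : ‖u‖ ^ 2 = ‖u‖ := by
      rw [← norm_star u, ← norm_pow, eq_neg_of_add_eq_zero_left h, norm_neg, norm_star]
    have hn1 : ‖u‖ = 1 := by
      have : ‖u‖ ≠ 0 := norm_ne_zero_iff.2 hu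
      exact mul_right_cancel₀ this (by rw [one_mul, ← sq, hn])
    have := mul_star_eq_one hn1
    linear_combination u ^ 2 * h - (u * star u + 1) * this
  · rintro (rfl | h)
    · simp
    · have := mul_star_eq_one (norm_eq_one_of_cube_eq_neg_one h)
      linear_combination star u ^ 2 * h - (u ^ 2 * star u + u) * this

theorem fibreLocus_cubicScroll : fibreLocus 3 cubicScroll = sphereMap ''
    {((0 : ℂ) : OnePoint ℂ), ((-1 : ℂ) : OnePoint ℂ),
      ((1 / 2 + Complex.I * (√3 / 2) : ℂ) : OnePoint ℂ),
      ((1 / 2 - Complex.I * (√3 / 2) : ℂ) : OnePoint ℂ), OnePoint.infty} := by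
  have e : fibreLocus 3 cubicScroll = {q | twistorProj ⁻¹' {q} ⊆ cubicScroll} := by
    ext q
    refine ⟨fun h => h.2, fun h => ⟨?_, h⟩⟩
    change Set.encard _ ≠ _
    rw [encard_fibre_of_subset h]
    exact fun h => absurd h (by decide)
  rw [e]
  ext q
  simp only [Set.image_insert_eq, Set.image_singleton, Set.mem_insert_iff, Set.mem_singleton_iff,
    sphereMap_coe, sphereMap_infty]
  rcases eq_infinityPoint_or_affinePoint q with rfl | ⟨u, v, rfl⟩
  · simpa using infinityPoint_fibre_subset
  · simp only [Set.mem_ofPred_eq, affinePoint_fibre_subset_iff, star_sq_add_self_eq_zero_iff,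
      cube_eq_neg_one_iff, affinePoint_inj, affinePoint_ne_infinityPoint]
    tauto

theorem encard_fibre_eq_top_or_two_or_three (q : HP1) :
    q ∈ fibreLocus 3 cubicScroll ∧ (twistorProj ⁻¹' {q} ∩ cubicScroll).encard = ⊤ ∨
    q ∉ fibreLocus 3 cubicScroll ∧ ((twistorProj ⁻¹' {q} ∩ cubicScroll).encard = 2 ∨
      (twistorProj ⁻¹' {q} ∩ cubicScroll).encard = 3) := by
  by_cases h : twistorProj ⁻¹' {q} ⊆ cubicScroll
  · have e := encard_fibre_of_subset h
    refine Or.inl ⟨⟨?_, h⟩, e⟩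
    change Set.encard _ ≠ _
    rw [e]
    exact fun h => absurd h (by decide)
  · refine Or.inr ⟨fun h' => h h'.2, ?_⟩
    rcases eq_infinityPoint_or_affinePoint q with rfl | ⟨u, v, rfl⟩
    · exact absurd infinityPoint_fibre_subset h
    · by_cases hv : v = 0
      · subst hv
        exact Or.inl (encard_fibre_of_eq_zero fun hu =>
          h ((affinePoint_fibre_subset_iff u 0).2 ⟨rfl, hu⟩))
      · exact encard_fibre_eq_two_or_three u hv

theorem countLocus_one_cubicScroll : countLocus 1 cubicScroll = ∅ := by
  refine Set.eq_empty_of_forall_notMem fun q hq => ?_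
  have hq' : (twistorProj ⁻¹' {q} ∩ cubicScroll).encard = 1 := hq
  rcases encard_fibre_eq_top_or_two_or_three q with ⟨-, h⟩ | ⟨-, h | h⟩ <;> rw [hq'] at h <;>
    exact absurd h (by decide)

theorem countLocus_two_cubicScroll :
    countLocus 2 cubicScroll = discLocus 3 cubicScroll \ fibreLocus 3 cubicScroll := by
  ext q
  change (Set.encard _ = 2) ↔ (Set.encard _ ≠ 3) ∧ _
  rcases encard_fibre_eq_top_or_two_or_three q with ⟨h', h⟩ | ⟨h', h | h⟩ <;> rw [h]
  · exact iff_of_false (by decide) fun h => h.2 h'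
  · exact iff_of_true rfl ⟨by decide, h'⟩
  · exact iff_of_false (by decide) fun h => h.1 rfl

theorem theorem5p6 :
    Nonempty (Set.range sphereMap ≃ₜ Metric.sphere (0 : EuclideanSpace ℝ (Fin 3)) 1) ∧
    ∃ F : ModelSurface → HP1,
      Topology.IsEmbedding F ∧
      (∀ z : OnePoint ℂ, F (modelBase z) = sphereMap z) ∧
      discLocus 3 cubicScroll = Set.range sphereMap ∪ ⋃ h : HandleIndex, F '' modelHandle h ∧
      fibreLocus 3 cubicScroll = sphereMap ''
        {((0 : ℂ) : OnePoint ℂ), ((-1 : ℂ) : OnePoint ℂ),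
          ((1 / 2 + Complex.I * (Real.sqrt 3 / 2) : ℂ) : OnePoint ℂ),
          ((1 / 2 - Complex.I * (Real.sqrt 3 / 2) : ℂ) : OnePoint ℂ),
          OnePoint.infty} ∧
      countLocus 1 cubicScroll = ∅ ∧
      countLocus 2 cubicScroll =
        (Set.range sphereMap ∪ ⋃ h : HandleIndex, F '' modelHandle h) \
          fibreLocus 3 cubicScroll := by

  have himg (h : HandleIndex) : modelMap '' modelHandle h = Set.range (handleMap h) :=
    PinchedHandles.image_lift_handle _ _ _ _ h
  refine ⟨nonempty_range_sphereMap_homeomorph, modelMap, isEmbedding_modelMap, fun _ => rfl, ?_,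
    fibreLocus_cubicScroll, countLocus_one_cubicScroll, ?_⟩
  · simp only [himg]
    exact discLocus_cubicScroll
  · simp only [himg]
    rw [← discLocus_cubicScroll]
    exact countLocus_two_cubicScroll
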